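/- Let $\mathbf{k}$ be a field, let $n\ge k\ge 0$ be integers, and let $X=\mathbb{P}^n\times\mathbb{P}^k$, with Cox ring $S=\mathbf{k}[x_0,\ldots,x_n,y_0,\ldots,y_k]$ (graded by $\mathrm{Cl}(X)=\mathbb{Z}^2$, with $\deg x_i=(1,0)$ and $\deg y_j=(0,1)$) and irrelevant ideal $B=\langle x_0,\ldots,x_n\rangle\cap\langle y_0,\ldots,y_k\rangle$. A labeled simplicial complex $(\Delta,\ell)$ is a simplicial complex $\Delta$ (containing the empty simplex) with a monomial $\ell(\sigma)\in S$ for each $\sigma\in\Delta$ such that $\ell(\tau)\mid\ell(\sigma)$ whenever $\tau\subseteq\sigma$; it is lcm-labeled if $\ell(\emptyset)=1$ and $\ell(\sigma)$ is the least common multiple of the labels of the vertices of $\sigma$. Its free complex $F_\Delta$ has the terms $F_{\Delta,i}=\bigoplus_{\sigma\in\Delta,\ \dim\sigma=i-1}S(-\deg\ell(\sigma))$ for $i\ge 0$ and the differential $\partial[\sigma]=\sum_{\tau}\pm\frac{\ell(\sigma)}{\ell(\tau)}[\tau]$, the sum over the facets $\tau$ of $\sigma$, with the usual simplicial signs. For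 an lcm-labeled $\Delta$ and a homogeneous ideal $I$, $F_\Delta$ is a virtual resolution of $S/I$ if the complex of sheaves $F_\Delta^\sim$ on $X$ is a locally free resolution of $(S/I)^\sim$. Let $\Delta=\diamondsuit^k$ be the bipyramid over a $k$-simplex, that is, the join of the simplex $\omega=\{v_0,\ldots,v_k\}$ with the complex consisting of two isolated points $w_0,w_1$. Let $\ell$ be an lcm-labeling of $\Delta$ such that $F_\Delta$ is a virtual resolution of $S/I$ for a monomial ideal $I\subseteq S$. Let $\Delta'=\{\sigma\in\Delta:\omega\not\subseteq\sigma\}\cup\{\sigma\cup\{v'\}:\sigma\cup\omega\in\Delta,\ \omega\not\subseteq\sigma\}$ be the stellar subdivision of $\Delta$ at a point $v'$ in $\omega$, where $v'$ is a new vertex, and let $\ell'$ be an lcm-labeling of $\Delta'$ such that $\ell'(\tau)=\ell(\tau)$ for all $\tau\in\Delta\cap\Delta'$. Suppose that the subdivision is virtual compatible, that is, 1. $\ell'(v')$ divides $\ell(\omega)$, and 2. $\ell'(v')\in\langle\ell(v_0),\ldots,\ell(v_k)\rangle:B^\infty$. If $\ell'(v')$ divides $\mathrm{lcm}(\ell(w_0),\ell(w_1))$,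 then $F_{\Delta'}$ is a free resolution of $S/J$, where $J=I_\Delta+\langle\ell'(v')\rangle$ and $I_\Delta$ is the ideal generated by the labels $\ell(v_0),\ldots,\ell(v_k),\ell(w_0),\ell(w_1)$ of the vertices of $\Delta$. In particular, $J=I+\langle\ell'(v')\rangle$ if $I=I_\Delta$. -/

import Mathlib

namespace VirtualRes

open MvPolynomial

universe u v w

/-! ### Simplicial complexes -/

/-- A simplicial complex with vertices in `V`: a downward closed collection of finite subsets of
`V`. The empty simplex, of dimension `-1`, belongs to every non-empty complex. -/
structure Complex (V : Type v) where
  faces : Set (Finset V)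
  down_closed : ∀ {s t : Finset V}, s ∈ faces → t ⊆ s → t ∈ faces

/-- A single simplex `s`, viewed as the complex `2^s`. -/
def Complex.simplex {V : Type v} (s : Finset V) : Complex V where
  faces := {t | t ⊆ s}
  down_closed hs ht := ht.trans hs

/-- The complex with the two vertices `w₀`, `w₁` and no edge. -/
def Complex.twoPoints {V : Type v} (w₀ w₁ : V) : Complex V where
  faces := {t | t ⊆ {w₀} ∨ t ⊆ {w₁}}
  down_closed hs ht := hs.imp ht.trans ht.trans

/-- The join of two complexes (used for complexes on disjoint vertex sets). -/
def Complex.join {V : Type v} [DecidableEq V] (K L : Complex V) : Complex V where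
  faces := {r | ∃ s ∈ K.faces, ∃ t ∈ L.faces, r = s ∪ t}
  down_closed := by
    rintro _ r ⟨s, hs, t, ht, rfl⟩ hr
    refine ⟨r ∩ s, K.down_closed hs Finset.inter_subset_right,
      r ∩ t, L.down_closed ht Finset.inter_subset_right, ?_⟩
    rw [← Finset.inter_union_distrib_left, Finset.inter_eq_left.2 hr]

/-- The bipyramid over the simplex `ω` with the two apexes `w₀`, `w₁`: the join of a pair of
vertices and a simplex. For `ω.card = k + 1`, `w₀ ≠ w₁` and `w₀, w₁ ∉ ω` this is `♢^k`. -/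
def Complex.bipyramid {V : Type v} [DecidableEq V] (ω : Finset V) (w₀ w₁ : V) : Complex V :=
  (Complex.twoPoints w₀ w₁).join (Complex.simplex ω)

/-- The faces of the stellar subdivision of `K` at a point `v'` in the simplex `ω`. -/
def Complex.stellarFaces {V : Type v} [DecidableEq V] (K : Complex V) (ω : Finset V) (v' : V) :
    Set (Finset V) :=
  (K.faces \ {s | ω ⊆ s}) ∪ {r | ∃ s : Finset V, s ∪ ω ∈ K.faces ∧ ¬ ω ⊆ s ∧ r = insert v' s}

/-! ### Labeled simplicial complexes

A monomial `x^a` is given by its exponent vector `a : ι →₀ ℕ`; divisibility of monomials is `≤`,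
the least common multiple is `⊔` and the quotient of a monomial by a divisor is `-`. -/

/-- A simplicial complex together with a labeling of its simplices by monomials in the variables
`x_i`, `i : ι`, such that `ℓ(t) ∣ ℓ(s)` for `t ⊆ s`. (The values of `label` outside `faces` play no
role.) -/
structure LabeledComplex (V : Type v) (ι : Type w) extends Complex V where
  label : Finset V → ι →₀ ℕ
  label_mono : ∀ {s t : Finset V}, s ∈ faces → t ⊆ s → label t ≤ label s

namespace LabeledComplex

section

variable {V : Type v} {ι : Type w}

/-- The labeling is an lcm-labeling: the label of each simplex is the least common multiple of the
labels of its vertices; in particular `ℓ(∅) = 1`. -/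
def IsLcmLabeled (Δ : LabeledComplex V ι) : Prop :=
  ∀ s ∈ Δ.faces, Δ.label s = s.sup fun x => Δ.label {x}

/-- The simplices of dimension `i - 1`. -/
abbrev Face (Δ : LabeledComplex V ι) (i : ℕ) : Type v :=
  {s : Finset V // s ∈ Δ.faces ∧ s.card = i}

variable (𝕜 : Type u) [Field 𝕜]

/-- The ideal generated by the labels of the vertices. -/
noncomputable def labelIdeal (Δ : LabeledComplex V ι) : Ideal (MvPolynomial ι 𝕜) :=
  Ideal.span {p | ∃ x : V, {x} ∈ Δ.faces ∧ p = monomial (Δ.label {x}) 1}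

/-- The free module on the simplices of dimension `i - 1`. -/
abbrev Chains (Δ : LabeledComplex V ι) (i : ℕ) : Type (max u v w) :=
  Δ.Face i →₀ MvPolynomial ι 𝕜

open Classical in
/-- The basis element `[s]` of a simplex `s` of dimension `i - 1`. -/
noncomputable def basisElt (Δ : LabeledComplex V ι) (i : ℕ) (s : Finset V) : Δ.Chains 𝕜 i :=
  if h : s ∈ Δ.faces ∧ s.card = i then Finsupp.single ⟨s, h⟩ 1 else 0

variable [LinearOrder V]

/-- The coefficient `± ℓ(s) / ℓ(t)` of `[t]` in the boundary of `[s]`, where `t = s \ {x}`; the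
sign comes from the orientations given by a fixed linear order of the vertices. -/
noncomputable def coeffErase (Δ : LabeledComplex V ι) (s : Finset V) (x : V) :
    MvPolynomial ι 𝕜 :=
  (-1) ^ (s.filter (· < x)).card * monomial (Δ.label s - Δ.label (s.erase x)) 1

/-- The differential `∂[s] = ∑ ± ℓ(s) / ℓ(t) [t]`, the sum over the facets `t` of `s`. -/
noncomputable def boundary (Δ : LabeledComplex V ι) (i : ℕ) :
    Δ.Chains 𝕜 (i + 1) →ₗ[MvPolynomial ι 𝕜] Δ.Chains 𝕜 i :=
  Finsupp.linearCombination (MvPolynomial ι 𝕜) fun s : Δ.Face (i + 1) =>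
    ∑ x ∈ s.1, Δ.coeffErase 𝕜 s.1 x • Δ.basisElt 𝕜 i (s.1.erase x)

theorem boundary_basisElt (Δ : LabeledComplex V ι) (i : ℕ) (s : Finset V)
    (hs : s ∈ Δ.faces) (hc : s.card = i + 1) :
    Δ.boundary 𝕜 i (Δ.basisElt 𝕜 (i + 1) s) =
      ∑ x ∈ s, Δ.coeffErase 𝕜 s x • Δ.basisElt 𝕜 i (s.erase x) := by
  simp [boundary, basisElt, hs, hc]

theorem coeffErase_anticomm (Δ : LabeledComplex V ι) {s : Finset V} (hs : s ∈ Δ.faces) {x y : V}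
    (hx : x ∈ s) (hxy : x < y) :
    Δ.coeffErase 𝕜 s x * Δ.coeffErase 𝕜 (s.erase x) y =
      -(Δ.coeffErase 𝕜 s y * Δ.coeffErase 𝕜 (s.erase y) x) := by
  have e1 : ((s.erase x).filter (· < y)).card + 1 = (s.filter (· < y)).card := by
    rw [Finset.filter_erase, Finset.card_erase_add_one]
    simp [hx, hxy]
  have e2 : (s.erase y).filter (· < x) = s.filter (· < x) := by
    rw [Finset.filter_erase, Finset.erase_eq_of_notMem]
    simp [hxy.le]
  have m : ∀ a b : V, Δ.label s - Δ.label (s.erase a) +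
      (Δ.label (s.erase a) - Δ.label ((s.erase a).erase b)) =
      Δ.label s - Δ.label ((s.erase a).erase b) := fun a b =>
    tsub_add_tsub_cancel (Δ.label_mono hs (Finset.erase_subset _ _))
      (Δ.label_mono (Δ.down_closed hs (Finset.erase_subset _ _)) (Finset.erase_subset _ _))
  have key : ∀ (a b : V) (p q : ℕ),
      ((-1) ^ p * monomial (Δ.label s - Δ.label (s.erase a)) (1 : 𝕜)) *
        ((-1) ^ q * monomial (Δ.label (s.erase a) - Δ.label ((s.erase a).erase b)) (1 : 𝕜)) =
      (-1) ^ (p + q) * monomial (Δ.label s - Δ.label ((s.erase a).erase b)) (1 : 𝕜) := by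
    intro a b p q
    rw [← m a b, ← one_mul (1 : 𝕜), ← monomial_mul, one_mul]
    ring
  unfold coeffErase
  rw [key, key, e2, ← e1, Finset.erase_right_comm]
  ring

theorem boundary_boundary (Δ : LabeledComplex V ι) (i : ℕ) :
    Δ.boundary 𝕜 i ∘ₗ Δ.boundary 𝕜 (i + 1) = 0 := by
  refine Finsupp.lhom_ext' fun s => LinearMap.ext_ring ?_
  obtain ⟨s, hs, hc⟩ := s
  have hb : Finsupp.single (⟨s, hs, hc⟩ : Δ.Face (i + 1 + 1)) (1 : MvPolynomial ι 𝕜) =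
      Δ.basisElt 𝕜 (i + 1 + 1) s := by simp [basisElt, hs, hc]
  simp only [LinearMap.comp_apply, Finsupp.lsingle_apply, LinearMap.zero_apply, hb]
  rw [boundary_basisElt 𝕜 Δ _ s hs hc, map_sum]
  have step : ∀ x ∈ s, Δ.boundary 𝕜 i (Δ.coeffErase 𝕜 s x • Δ.basisElt 𝕜 (i + 1) (s.erase x)) =
      ∑ y ∈ s.erase x, (Δ.coeffErase 𝕜 s x * Δ.coeffErase 𝕜 (s.erase x) y) •
        Δ.basisElt 𝕜 i ((s.erase x).erase y) := by
    intro x hx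
    rw [map_smul, boundary_basisElt 𝕜 Δ _ _ (Δ.down_closed hs (Finset.erase_subset _ _))
      (by rw [Finset.card_erase_of_mem hx, hc]; rfl), Finset.smul_sum]
    simp only [smul_smul]
  rw [Finset.sum_congr rfl step, Finset.sum_sigma']
  refine Finset.sum_involution (fun p _ => ⟨p.2, p.1⟩) ?_ ?_ ?_ ?_
  · rintro ⟨x, y⟩ h
    simp only [Finset.mem_sigma, Finset.mem_erase] at h
    obtain ⟨hx, hyx, hy⟩ := h
    dsimp only
    rw [Finset.erase_right_comm (a := y) (b := x), ← add_smul]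
    rcases lt_or_gt_of_ne hyx with hlt | hlt
    · rw [coeffErase_anticomm 𝕜 Δ hs hy hlt, add_neg_cancel, zero_smul]
    · rw [coeffErase_anticomm 𝕜 Δ hs hx hlt, neg_add_cancel, zero_smul]
  · rintro ⟨x, y⟩ h _ he
    simp only [Finset.mem_sigma, Finset.mem_erase] at h
    exact h.2.1 (Sigma.mk.inj he).1
  · rintro ⟨x, y⟩ h
    simp only [Finset.mem_sigma, Finset.mem_erase] at h ⊢
    exact ⟨h.2.2, h.2.1.symm, h.1⟩
  · rintro ⟨x, y⟩ _
    rfl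

/-- The free complex `F_Δ` of a labeled simplicial complex. -/
noncomputable def freeComplex (Δ : LabeledComplex V ι) :
    ChainComplex (ModuleCat.{max u v w} (MvPolynomial ι 𝕜)) ℕ :=
  ChainComplex.of (fun i => ModuleCat.of _ (Δ.Chains 𝕜 i))
    (fun i => ModuleCat.ofHom (Δ.boundary 𝕜 i)) fun i => by
      rw [← ModuleCat.ofHom_comp, boundary_boundary]
      rfl

end

end LabeledComplex

/-- A complex `C` (in non-negative homological degrees) is a free resolution of `M`: its terms are
free, it is exact in positive degrees, and `H_0(C) ≅ M`. -/
def IsFreeResolution {S : Type u} [CommRing S] (C : ChainComplex (ModuleCat.{v} S) ℕ)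
    (M : Type w) [AddCommGroup M] [Module S M] : Prop :=
  (∀ i, Module.Free S (C.X i)) ∧ (∀ i, 0 < i → C.ExactAt i) ∧
    Nonempty (C.homology 0 ≃ₗ[S] M)

/-! ### The toric variety `X = ℙⁿ × ℙᵏ` -/

/-- The variables `x_0, …, x_n, y_0, …, y_k`. -/
abbrev Vars (n k : ℕ) : Type := Fin (n + 1) ⊕ Fin (k + 1)

/-- The Cox ring `𝕜[x_0, …, x_n, y_0, …, y_k]` of `ℙⁿ × ℙᵏ`. -/
abbrev CoxRing (𝕜 : Type u) [Field 𝕜] (n k : ℕ) : Type u := MvPolynomial (Vars n k) 𝕜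

/-- The `Cl(X) = ℤ × ℤ`-degrees of the variables: `deg x_i = (1, 0)` and `deg y_j = (0, 1)`. -/
def varDegree (n k : ℕ) : Vars n k → ℤ × ℤ :=
  Sum.elim (fun _ => (1, 0)) (fun _ => (0, 1))

/-- The irrelevant ideal `B = ⟨x_0, …, x_n⟩ ∩ ⟨y_0, …, y_k⟩`. -/
noncomputable def irrelevantIdeal (𝕜 : Type u) [Field 𝕜] (n k : ℕ) : Ideal (CoxRing 𝕜 n k) :=
  Ideal.span (Set.range fun i : Fin (n + 1) => X (Sum.inl i)) ⊓
    Ideal.span (Set.range fun j : Fin (k + 1) => X (Sum.inr j))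

/-- The saturation `I : B^∞`, the (increasing) union of the colon ideals `I : B^d`. -/
def saturation {S : Type u} [CommRing S] (I B : Ideal S) : Ideal S :=
  ⨆ d : ℕ, I.colon ((B ^ d : Ideal S) : Set S)

/-- A monomial ideal: one generated by monomials. -/
def IsMonomialIdeal {𝕜 : Type u} [Field 𝕜] {ι : Type w} (I : Ideal (MvPolynomial ι 𝕜)) : Prop :=
  ∃ A : Set (ι →₀ ℕ), I = Ideal.span ((fun a => monomial a (1 : 𝕜)) '' A)

section Sheaves

variable {𝕜 : Type u} [Field 𝕜] {n k : ℕ}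

/-- The homogeneous elements of the Cox ring of a given degree in `Cl(X)`. -/
noncomputable def ringDegree (𝕜 : Type u) [Field 𝕜] (n k : ℕ) (d : ℤ × ℤ) :
    AddSubgroup (CoxRing 𝕜 n k) :=
  (weightedHomogeneousSubmodule 𝕜 (varDegree n k) d).toAddSubgroup

/-- The `Cl(X)`-grading of `S/I`. -/
noncomputable def quotientDegree (I : Ideal (CoxRing 𝕜 n k)) (d : ℤ × ℤ) :
    AddSubgroup (CoxRing 𝕜 n k ⧸ I) :=
  (ringDegree 𝕜 n k d).map (Ideal.Quotient.mk I).toAddMonoidHom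

/-- The `Cl(X)`-grading of the free module `⨁_s S(-deg ℓ(s))`, the sum over the simplices `s` of
dimension `i - 1`: the coefficient of `[s]` in an element of degree `d` has degree
`d - deg ℓ(s)`. -/
noncomputable def chainsDegree (𝕜 : Type u) [Field 𝕜] {V : Type v}
    (Δ : LabeledComplex V (Vars n k)) (i : ℕ) (d : ℤ × ℤ) : AddSubgroup (Δ.Chains 𝕜 i) where
  carrier := {c | ∀ s : Δ.Face i,
    c s ∈ ringDegree 𝕜 n k (d - Finsupp.weight (varDegree n k) (Δ.label s.1))}
  zero_mem' _ := zero_mem _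
  add_mem' hx hy s := add_mem (hx s) (hy s)
  neg_mem' hx s := neg_mem (hx s)

/-- The multiplicative set `{1, f, f², …}` for `f = x_a y_b`. The open sets `x_a y_b ≠ 0` form
an affine open cover of `X`. -/
noncomputable abbrev chartPowers (𝕜 : Type u) [Field 𝕜] (a : Fin (n + 1)) (b : Fin (k + 1)) :
    Submonoid (CoxRing 𝕜 n k) :=
  Submonoid.powers (X (Sum.inl a) * X (Sum.inr b))

/-- The sections over the affine open set `x_a y_b ≠ 0` of the sheaf `M^∼` on `X` associated to a
graded module `M = ⨁ M_d`: the elements of degree zero of the localization of `M` at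
`f = x_a y_b`, which are the fractions `m / f^N` with `m` homogeneous of degree
`N • deg f = (N, N)`. -/
def chartSections {M : Type v} [AddCommGroup M] [Module (CoxRing 𝕜 n k) M]
    (𝓜 : ℤ × ℤ → AddSubgroup M) (a : Fin (n + 1)) (b : Fin (k + 1)) :
    Set (LocalizedModule (chartPowers 𝕜 a b) M) :=
  {z | ∃ N : ℕ, ∃ m ∈ 𝓜 ((N : ℤ), (N : ℤ)),
    z = LocalizedModule.mk m ⟨(X (Sum.inl a) * X (Sum.inr b)) ^ N,
      (Submonoid.mem_powers_iff _ _).2 ⟨N, rfl⟩⟩}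

/-- The map induced on localizations at `x_a y_b`. -/
noncomputable def chartMap {M : Type v} {N : Type w} [AddCommGroup M] [AddCommGroup N]
    [Module (CoxRing 𝕜 n k) M] [Module (CoxRing 𝕜 n k) N]
    (φ : M →ₗ[CoxRing 𝕜 n k] N) (a : Fin (n + 1)) (b : Fin (k + 1)) :
    LocalizedModule (chartPowers 𝕜 a b) M →ₗ[CoxRing 𝕜 n k]
      LocalizedModule (chartPowers 𝕜 a b) N :=
  IsLocalizedModule.map (chartPowers 𝕜 a b)
    (LocalizedModule.mkLinearMap (chartPowers 𝕜 a b) M)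
    (LocalizedModule.mkLinearMap (chartPowers 𝕜 a b) N) φ

/-- The sequence `L^∼ → M^∼ → N^∼` of sheaves on `X` induced by graded maps `φ : L → M` and
`ψ : M → N` is exact at `M^∼`. The sheaves being quasi-coherent, this is exactness on the sections
over the affine open sets `x_a y_b ≠ 0`. -/
def SheafExact {L M N : Type*} [AddCommGroup L] [AddCommGroup M] [AddCommGroup N]
    [Module (CoxRing 𝕜 n k) L] [Module (CoxRing 𝕜 n k) M] [Module (CoxRing 𝕜 n k) N]
    (𝓛 : ℤ × ℤ → AddSubgroup L) (𝓜 : ℤ × ℤ → AddSubgroup M)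
    (φ : L →ₗ[CoxRing 𝕜 n k] M) (ψ : M →ₗ[CoxRing 𝕜 n k] N) : Prop :=
  ∀ (a : Fin (n + 1)) (b : Fin (k + 1)), ∀ z ∈ chartSections 𝓜 a b,
    chartMap ψ a b z = 0 ↔ ∃ y ∈ chartSections 𝓛 a b, chartMap φ a b y = z

/-- The map `M^∼ → N^∼` of sheaves on `X` induced by a graded map `φ : M → N` is surjective. -/
def SheafSurjective {M N : Type*} [AddCommGroup M] [AddCommGroup N]
    [Module (CoxRing 𝕜 n k) M] [Module (CoxRing 𝕜 n k) N]
    (𝓜 : ℤ × ℤ → AddSubgroup M) (𝓝 : ℤ × ℤ → AddSubgroup N)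
    (φ : M →ₗ[CoxRing 𝕜 n k] N) : Prop :=
  ∀ (a : Fin (n + 1)) (b : Fin (k + 1)), ∀ z ∈ chartSections 𝓝 a b,
    ∃ y ∈ chartSections 𝓜 a b, chartMap φ a b y = z

/-- The augmentation `F_{Δ,0} = S → S/I`, `[∅] ↦ 1`. -/
noncomputable def augmentation {V : Type v} (Δ : LabeledComplex V (Vars n k))
    (I : Ideal (CoxRing 𝕜 n k)) : Δ.Chains 𝕜 0 →ₗ[CoxRing 𝕜 n k] CoxRing 𝕜 n k ⧸ I :=
  Finsupp.linearCombination (CoxRing 𝕜 n k) fun _ => 1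

/-- For a labeled complex with `ℓ(∅) = 1`, so that `F_{Δ,0} = S`: the complex `F_Δ` is a virtual
resolution of `S/I`, that is, the sequence of sheaves `⋯ → F_2^∼ → F_1^∼ → F_0^∼ → (S/I)^∼ → 0` on
`X` is exact. (The kernel of any surjection `F_0^∼ = 𝒪_X → (S/I)^∼` is the annihilator of the
target, so it makes no difference to ask for the natural augmentation here.) -/
def IsVirtualResolution {V : Type v} [LinearOrder V] (Δ : LabeledComplex V (Vars n k))
    (I : Ideal (CoxRing 𝕜 n k)) : Prop :=
  (∀ i, SheafExact (chainsDegree 𝕜 Δ (i + 2)) (chainsDegree 𝕜 Δ (i + 1))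
      (Δ.boundary 𝕜 (i + 1)) (Δ.boundary 𝕜 i)) ∧
    SheafExact (chainsDegree 𝕜 Δ 1) (chainsDegree 𝕜 Δ 0)
      (Δ.boundary 𝕜 0) (augmentation Δ I) ∧
    SheafSurjective (chainsDegree 𝕜 Δ 0) (quotientDegree I) (augmentation Δ I)

end Sheaves

/-- `Δ'` is a virtual compatible subdivision of `Δ` at a point `v'` in the simplex `ω`. -/
structure IsVirtualCompatibleSubdivision (𝕜 : Type u) [Field 𝕜] {n k : ℕ} {V : Type v}
    [DecidableEq V] (Δ Δ' : LabeledComplex V (Vars n k)) (ω : Finset V) (v' : V) : Prop where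
  mem_faces : ω ∈ Δ.faces
  new_vertex : {v'} ∉ Δ.faces
  faces_eq : Δ'.faces = Δ.toComplex.stellarFaces ω v'
  label_eq : ∀ s ∈ Δ.faces, s ∈ Δ'.faces → Δ'.label s = Δ.label s
  /-- `ℓ'(v')` divides `ℓ(ω)`. -/
  label_le : Δ'.label {v'} ≤ Δ.label ω
  /-- `ℓ'(v') ∈ ⟨ℓ(v_0), …, ℓ(v_r)⟩ : B^∞`, where `v_0, …, v_r` are the vertices of `ω`. -/
  label_mem : (monomial (Δ'.label {v'}) 1 : CoxRing 𝕜 n k) ∈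
    saturation (Ideal.span ((fun x => monomial (Δ.label {x}) 1) '' (ω : Set V)))
      (irrelevantIdeal 𝕜 n k)

end VirtualRes

namespace VirtualRes

open MvPolynomial

universe u v w

/-! The complex splits, as a complex of `𝕜`-vector spaces, into its multidegrees: in multidegree `b`
it is the simplicial chain complex, over `𝕜`, of the subcomplex of faces of `Δ'` whose label divides
`x^b`. It suffices that each such subcomplex is a cone or has no non-empty face.

If `ℓ'(v')` divides `x^b`, the subcomplex is a cone with apex `v'`, because every maximal face of a
bipyramid contains `ω`. Otherwise its vertices are old ones. They include neither both apexes, as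
`ℓ'(v')` divides their lcm, nor all of `ω`, as `ℓ'(v')` divides `ℓ(ω)`. The vertices thus span a
face of `Δ` that survives in `Δ'`, so the subcomplex is a simplex and any vertex serves as apex
(`exists_isConeVertex`).

Coning in each multidegree assembles to a `𝕜`-linear contracting homotopy in positive degrees
(`coneMap_homotopy`), while `H_0` is the quotient by the vertex labels (`ker_labelAugmentation`,
`labelIdeal_eq`). -/

namespace LabeledComplex

variable {V : Type v} {ι : Type w} (𝕜 : Type u) [Field 𝕜]

/-! ### Multigraded pieces of the chains, and the augmentation -/

/-- The element `x^b / ℓ(s) • [s]` of multidegree `b`. -/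
noncomputable def scaledElt (Δ : LabeledComplex V ι) (i : ℕ) (b : ι →₀ ℕ) (s : Finset V) :
    Δ.Chains 𝕜 i :=
  monomial (b - Δ.label s) (1 : 𝕜) • Δ.basisElt 𝕜 i s

/-- The left-hand sides form a `𝕜`-basis of the chains, so `𝕜`-linear identities need checking only
on the elements `scaledElt` with `ℓ(s) ∣ x^b`, where the truncated subtraction is a true quotient.
-/
theorem single_monomial_eq_scaledElt (Δ : LabeledComplex V ι) (i : ℕ) (s : Δ.Face i)
    (m : ι →₀ ℕ) :
    Finsupp.single s (monomial m (1 : 𝕜)) = Δ.scaledElt 𝕜 i (m + Δ.label s.1) s.1 := by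
  simp [scaledElt, basisElt, s.2.1, s.2.2]

/-- In each multidegree `b`, every non-empty face whose label divides `x^b` can be coned with the
vertex `c b` without leaving the subcomplex of faces whose labels divide `x^b`. -/
def IsConeVertex [DecidableEq V] (Δ : LabeledComplex V ι) (c : (ι →₀ ℕ) → V) : Prop :=
  ∀ b, ∀ s ∈ Δ.faces, s.Nonempty → Δ.label s ≤ b →
    insert (c b) s ∈ Δ.faces ∧ Δ.label (insert (c b) s) ≤ b

/-- The augmentation of the free complex of a labeled complex to the quotient by its label ideal. -/
noncomputable def labelAugmentation (Δ : LabeledComplex V ι) :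
    Δ.Chains 𝕜 0 →ₗ[MvPolynomial ι 𝕜] MvPolynomial ι 𝕜 ⧸ Δ.labelIdeal 𝕜 :=
  Finsupp.linearCombination (MvPolynomial ι 𝕜) fun _ => 1

theorem chains_zero_eq_smul (Δ : LabeledComplex V ι) (z : Δ.Chains 𝕜 0) :
    ∃ p : MvPolynomial ι 𝕜, z = p • Δ.basisElt 𝕜 0 ∅ := by
  induction z using Finsupp.induction_linear with
  | zero => exact ⟨0, by simp⟩
  | add f g hf hg =>
    obtain ⟨p, rfl⟩ := hf
    obtain ⟨q, rfl⟩ := hg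
    exact ⟨p + q, (add_smul _ _ _).symm⟩
  | single s p =>
    obtain ⟨s, hs, hc⟩ := s
    obtain rfl := Finset.card_eq_zero.1 hc
    exact ⟨p, by simp [basisElt, hs]⟩

theorem labelAugmentation_smul_basisElt {Δ : LabeledComplex V ι} (h : ∅ ∈ Δ.faces)
    (p : MvPolynomial ι 𝕜) :
    Δ.labelAugmentation 𝕜 (p • Δ.basisElt 𝕜 0 ∅) = Ideal.Quotient.mk (Δ.labelIdeal 𝕜) p := by
  have h1 : Δ.labelAugmentation 𝕜 (Δ.basisElt 𝕜 0 ∅) = Ideal.Quotient.mk (Δ.labelIdeal 𝕜) 1 := by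
    simp [labelAugmentation, basisElt, h]
  rw [map_smul, h1]
  change Ideal.Quotient.mk (Δ.labelIdeal 𝕜) (p * 1) = _
  rw [mul_one]

theorem labelAugmentation_surjective {Δ : LabeledComplex V ι} (h : ∅ ∈ Δ.faces) :
    Function.Surjective (Δ.labelAugmentation 𝕜) := by
  intro q
  obtain ⟨p, rfl⟩ := Ideal.Quotient.mk_surjective q
  exact ⟨p • Δ.basisElt 𝕜 0 ∅, labelAugmentation_smul_basisElt 𝕜 h p⟩

variable [LinearOrder V]

/-! ### The cone homotopy -/

/-- The monomial coefficients are absorbed by the fixed multidegree, leaving the ordinary simplicial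
boundary with coefficients `±1`. -/
theorem boundary_scaledElt (Δ : LabeledComplex V ι) (i : ℕ) (b : ι →₀ ℕ) {s : Finset V}
    (hs : s ∈ Δ.faces) (hc : s.card = i + 1) (hb : Δ.label s ≤ b) :
    Δ.boundary 𝕜 i (Δ.scaledElt 𝕜 (i + 1) b s) =
      ∑ x ∈ s, (-1 : 𝕜) ^ (s.filter (· < x)).card • Δ.scaledElt 𝕜 i b (s.erase x) := by
  rw [scaledElt, map_smul, boundary_basisElt 𝕜 Δ i s hs hc, Finset.smul_sum]
  refine Finset.sum_congr rfl fun x _ => ?_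
  rw [scaledElt, coeffErase, smul_smul, ← smul_assoc]
  congr 1
  rw [mul_left_comm, monomial_mul, one_mul,
    tsub_add_tsub_cancel hb (Δ.label_mono hs (Finset.erase_subset _ _)), MvPolynomial.smul_eq_C_mul]
  simp

/-- The sign of the vertex `x` in the simplex `insert x s`. -/
def vertexSign (s : Finset V) (x : V) : 𝕜 := (-1) ^ (s.filter (· < x)).card

/-- The operation of coning with the vertex `c b` in each multidegree `b`. -/
noncomputable def coneMap (Δ : LabeledComplex V ι) (c : (ι →₀ ℕ) → V) (i : ℕ) :
    Δ.Chains 𝕜 i →ₗ[𝕜] Δ.Chains 𝕜 (i + 1) :=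
  Finsupp.lsum 𝕜 fun s : Δ.Face i => (basisMonomials ι 𝕜).constr 𝕜 fun m =>
    if c (m + Δ.label s.1) ∈ s.1 then 0 else
      vertexSign 𝕜 s.1 (c (m + Δ.label s.1)) •
        Δ.scaledElt 𝕜 (i + 1) (m + Δ.label s.1) (insert (c (m + Δ.label s.1)) s.1)

/-- Coning preserves the multidegree, but is only `𝕜`-linear in general, since the apex `c b` varies
with `b`. -/
theorem coneMap_scaledElt (Δ : LabeledComplex V ι) (c : (ι →₀ ℕ) → V) (i : ℕ) (b : ι →₀ ℕ)
    {s : Finset V} (hs : s ∈ Δ.faces) (hc : s.card = i) (hb : Δ.label s ≤ b) :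
    Δ.coneMap 𝕜 c i (Δ.scaledElt 𝕜 i b s) =
      if c b ∈ s then 0 else
        vertexSign 𝕜 s (c b) • Δ.scaledElt 𝕜 (i + 1) b (insert (c b) s) := by
  have h := Δ.single_monomial_eq_scaledElt 𝕜 i ⟨s, hs, hc⟩ (b - Δ.label s)
  simp only [tsub_add_cancel_of_le hb] at h
  have hm : (monomial (b - Δ.label s) (1 : 𝕜) : MvPolynomial ι 𝕜) =
      basisMonomials ι 𝕜 (b - Δ.label s) := by rw [coe_basisMonomials]
  rw [← h, coneMap, Finsupp.lsum_single, hm, Module.Basis.constr_basis]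
  simp only [tsub_add_cancel_of_le hb]

theorem vertexSign_mul_self (s : Finset V) (x : V) :
    vertexSign 𝕜 s x * vertexSign 𝕜 s x = 1 := by
  rw [vertexSign, ← mul_pow]; simp

theorem vertexSign_erase_self (s : Finset V) (x : V) :
    vertexSign 𝕜 (s.erase x) x = vertexSign 𝕜 s x := by
  rw [vertexSign, vertexSign, Finset.filter_erase, Finset.erase_eq_of_notMem]
  simp

/-- Whichever of `x` and `c` comes first shifts the position of the other by one, so exactly one of
the two signs flips. -/
theorem vertexSign_insert_mul {s : Finset V} {x c : V} (hx : x ∈ s) (hc : c ∉ s) :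
    vertexSign 𝕜 s c * vertexSign 𝕜 (insert c s) x =
      -(vertexSign 𝕜 s x * vertexSign 𝕜 (s.erase x) c) := by
  have hne : x ≠ c := fun h => hc (h ▸ hx)
  unfold vertexSign
  rcases lt_or_gt_of_ne hne with h | h
  · have e1 : ((s.erase x).filter (· < c)).card + 1 = (s.filter (· < c)).card := by
      rw [Finset.filter_erase, Finset.card_erase_add_one]
      simp [hx, h]
    have e2 : (insert c s).filter (· < x) = s.filter (· < x) := by
      rw [Finset.filter_insert, if_neg h.not_gt]
    rw [e2, ← e1]; ring
  · have e1 : (s.erase x).filter (· < c) = s.filter (· < c) := by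
      rw [Finset.filter_erase, Finset.erase_eq_of_notMem]
      simp [h.le]
    have e2 : ((insert c s).filter (· < x)).card = (s.filter (· < x)).card + 1 := by
      rw [Finset.filter_insert, if_pos h, Finset.card_insert_of_notMem (by simp [hc])]
    rw [e1, e2]; ring

theorem coneMap_homotopy_scaledElt {Δ : LabeledComplex V ι} {c : (ι →₀ ℕ) → V}
    (hΔ : Δ.IsConeVertex c) (i : ℕ) (b : ι →₀ ℕ) {s : Finset V} (hs : s ∈ Δ.faces)
    (hcard : s.card = i + 1) (hb : Δ.label s ≤ b) :
    Δ.boundary 𝕜 (i + 1) (Δ.coneMap 𝕜 c (i + 1) (Δ.scaledElt 𝕜 (i + 1) b s)) +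
      Δ.coneMap 𝕜 c i (Δ.boundary 𝕜 i (Δ.scaledElt 𝕜 (i + 1) b s)) =
      Δ.scaledElt 𝕜 (i + 1) b s := by
  have hne : s.Nonempty := Finset.card_pos.1 (by omega)
  obtain ⟨hf, hl⟩ := hΔ b s hs hne hb
  rw [coneMap_scaledElt 𝕜 Δ c (i + 1) b hs hcard hb, boundary_scaledElt 𝕜 Δ i b hs hcard hb,
    map_sum]
  have step : ∀ x ∈ s, Δ.coneMap 𝕜 c i
      ((-1 : 𝕜) ^ (s.filter (· < x)).card • Δ.scaledElt 𝕜 i b (s.erase x)) =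
      vertexSign 𝕜 s x • if c b ∈ s.erase x then 0 else
        vertexSign 𝕜 (s.erase x) (c b) •
          Δ.scaledElt 𝕜 (i + 1) b (insert (c b) (s.erase x)) := by
    intro x hx
    rw [map_smul, coneMap_scaledElt 𝕜 Δ c i b (Δ.down_closed hs (Finset.erase_subset _ _))
      (by rw [Finset.card_erase_of_mem hx, hcard]; rfl)
      ((Δ.label_mono hs (Finset.erase_subset _ _)).trans hb)]
    rfl
  rw [Finset.sum_congr rfl step]
  by_cases hcs : c b ∈ s
  -- The cone over `s` is zero, and of its facets only the one opposite `c b` has a non-zero cone,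
  -- namely `s` itself.
  · rw [if_pos hcs, map_zero, zero_add, Finset.sum_eq_single_of_mem _ hcs]
    · rw [if_neg (Finset.notMem_erase _ _), Finset.insert_erase hcs, smul_smul,
        vertexSign_erase_self, vertexSign_mul_self, one_smul]
    · intro x _ hx
      rw [if_pos (Finset.mem_erase.2 ⟨hx.symm, hcs⟩), smul_zero]
  -- The facet of the cone opposite `c b` gives back `s`; the other facets cancel against the cones
  -- over the facets of `s`.
  · rw [if_neg hcs, LinearMap.map_smul_of_tower, boundary_scaledElt 𝕜 Δ (i + 1) b hf
      (by rw [Finset.card_insert_of_notMem hcs, hcard]) hl, Finset.sum_insert hcs,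
      Finset.erase_insert hcs, smul_add, smul_smul, add_assoc, Finset.smul_sum,
      ← Finset.sum_add_distrib, Finset.sum_eq_zero, add_zero]
    · have : ((-1 : 𝕜) ^ ((insert (c b) s).filter (· < c b)).card) = vertexSign 𝕜 s (c b) := by
        rw [← vertexSign, ← vertexSign_erase_self, Finset.erase_insert hcs]
      rw [this, vertexSign_mul_self, one_smul]
    · intro x hx
      have hxc : c b ≠ x := fun h => hcs (h ▸ hx)
      rw [if_neg fun h => hcs (Finset.mem_of_mem_erase h), smul_smul, smul_smul,
        ← vertexSign, vertexSign_insert_mul 𝕜 hx hcs, Finset.erase_insert_of_ne hxc, ← add_smul,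
        neg_add_cancel, zero_smul]

theorem coneMap_homotopy {Δ : LabeledComplex V ι} {c : (ι →₀ ℕ) → V}
    (hΔ : Δ.IsConeVertex c) (i : ℕ) (z : Δ.Chains 𝕜 (i + 1)) :
    Δ.boundary 𝕜 (i + 1) (Δ.coneMap 𝕜 c (i + 1) z) +
      Δ.coneMap 𝕜 c i (Δ.boundary 𝕜 i z) = z := by
  suffices h : ((Δ.boundary 𝕜 (i + 1)).restrictScalars 𝕜) ∘ₗ Δ.coneMap 𝕜 c (i + 1) +
      Δ.coneMap 𝕜 c i ∘ₗ ((Δ.boundary 𝕜 i).restrictScalars 𝕜) = LinearMap.id from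
    LinearMap.congr_fun h z
  refine Finsupp.lhom_ext' fun s => (basisMonomials ι 𝕜).ext fun m => ?_
  simp only [coe_basisMonomials, LinearMap.comp_apply, Finsupp.lsingle_apply,
    LinearMap.add_apply, LinearMap.id_apply, LinearMap.restrictScalars_apply]
  rw [single_monomial_eq_scaledElt]
  exact coneMap_homotopy_scaledElt 𝕜 hΔ i _ s.2.1 s.2.2 le_add_self

/-! ### Homology in degree zero, and the resolution criterion -/

theorem boundary_vertex {Δ : LabeledComplex V ι} (h0 : Δ.label ∅ = 0) {x : V}
    (hx : {x} ∈ Δ.faces) :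
    Δ.boundary 𝕜 0 (Δ.basisElt 𝕜 1 {x}) =
      monomial (Δ.label {x}) (1 : 𝕜) • Δ.basisElt 𝕜 0 ∅ := by
  rw [boundary_basisElt 𝕜 Δ 0 {x} hx (Finset.card_singleton x), Finset.sum_singleton]
  simp [coeffErase, h0, Finset.filter_singleton]

theorem ker_labelAugmentation {Δ : LabeledComplex V ι} (h : ∅ ∈ Δ.faces) (h0 : Δ.label ∅ = 0) :
    LinearMap.ker (Δ.labelAugmentation 𝕜) = LinearMap.range (Δ.boundary 𝕜 0) := by
  apply le_antisymm
  · intro z hz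
    obtain ⟨p, rfl⟩ := Δ.chains_zero_eq_smul 𝕜 z
    rw [LinearMap.mem_ker, labelAugmentation_smul_basisElt 𝕜 h] at hz
    have hp : p ∈ Δ.labelIdeal 𝕜 := Ideal.Quotient.eq_zero_iff_mem.1 hz
    -- Pulling the range back along `p ↦ p • [∅]` turns it into an ideal, so only the generators
    -- need checking.
    have : Δ.labelIdeal 𝕜 ≤ (LinearMap.range (Δ.boundary 𝕜 0)).comap
        (LinearMap.toSpanSingleton (MvPolynomial ι 𝕜) _ (Δ.basisElt 𝕜 0 ∅)) := by
      refine Ideal.span_le.2 ?_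
      rintro _ ⟨x, hx, rfl⟩
      exact ⟨_, boundary_vertex 𝕜 h0 hx⟩
    exact this hp
  · rw [LinearMap.range_le_ker_iff]
    refine Finsupp.lhom_ext' fun s => LinearMap.ext_ring ?_
    obtain ⟨s, hs, hc⟩ := s
    obtain ⟨x, rfl⟩ := Finset.card_eq_one.1 hc
    have hb : Finsupp.single (⟨{x}, hs, hc⟩ : Δ.Face (0 + 1)) (1 : MvPolynomial ι 𝕜) =
        Δ.basisElt 𝕜 1 {x} := by simp [basisElt, hs]
    simp only [LinearMap.comp_apply, Finsupp.lsingle_apply, LinearMap.zero_apply, hb]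
    rw [boundary_vertex 𝕜 h0 hs, labelAugmentation_smul_basisElt 𝕜 h]
    exact Ideal.Quotient.eq_zero_iff_mem.2 (Ideal.subset_span ⟨x, hs, rfl⟩)

open CategoryTheory in
/-- A labeled complex having a cone vertex in each multidegree supports a free resolution. -/
theorem isFreeResolution_of_isConeVertex {Δ : LabeledComplex V ι} (h : ∅ ∈ Δ.faces)
    (h0 : Δ.label ∅ = 0) {c : (ι →₀ ℕ) → V} (hΔ : Δ.IsConeVertex c) :
    IsFreeResolution (Δ.freeComplex 𝕜) (MvPolynomial ι 𝕜 ⧸ Δ.labelIdeal 𝕜) := by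
  have hd : ∀ i, (Δ.freeComplex 𝕜).d (i + 1) i = ModuleCat.ofHom (Δ.boundary 𝕜 i) :=
    fun i =>
    ChainComplex.of_d (fun i => ModuleCat.of _ (Δ.Chains 𝕜 i))
      (fun i => ModuleCat.ofHom (Δ.boundary 𝕜 i)) i
  refine ⟨fun i => ?_, fun i hi => ?_, ?_⟩
  · exact Module.Free.finsupp _ _ _
  · obtain ⟨i, rfl⟩ := Nat.exists_eq_add_of_lt hi
    rw [zero_add, HomologicalComplex.exactAt_iff' _ (i + 2) (i + 1) i (by simp) (by simp),
      ShortComplex.moduleCat_exact_iff]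
    intro z hz
    have hz' : Δ.boundary 𝕜 i z = 0 := by
      have : (ModuleCat.ofHom (Δ.boundary 𝕜 i)).hom z = 0 := by
        rw [← hd]
        exact hz
      exact this
    refine ⟨Δ.coneMap 𝕜 c (i + 1) z, ?_⟩
    have := coneMap_homotopy 𝕜 hΔ i z
    rw [hz', map_zero, add_zero] at this
    change ((Δ.freeComplex 𝕜).d (i + 1 + 1) (i + 1)).hom (Δ.coneMap 𝕜 c (i + 1) z) = z
    rw [hd]
    exact this
  -- No differential leaves degree `0`, so `H_0` is the cokernel of the differential from degree
  -- `1`.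
  · let e : (Δ.freeComplex 𝕜).homology 0 ≃ₗ[MvPolynomial ι 𝕜]
        Δ.Chains 𝕜 0 ⧸ LinearMap.range ((Δ.freeComplex 𝕜).d (0 + 1) 0).hom :=
      ((Δ.freeComplex 𝕜).isoHomologyι₀ ≪≫
        (Δ.freeComplex 𝕜).opcyclesIsoSc' 1 0 0 (by simp) (by simp) ≪≫
        ((Δ.freeComplex 𝕜).sc' 1 0 0).moduleCatOpcyclesIso).toLinearEquiv
    have hr : LinearMap.range ((Δ.freeComplex 𝕜).d (0 + 1) 0).hom =
        LinearMap.ker (Δ.labelAugmentation 𝕜) := by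
      rw [ker_labelAugmentation 𝕜 h h0, hd]
      rfl
    let e' : (Δ.Chains 𝕜 0 ⧸ LinearMap.range ((Δ.freeComplex 𝕜).d (0 + 1) 0).hom)
        ≃ₗ[MvPolynomial ι 𝕜] Δ.Chains 𝕜 0 ⧸ LinearMap.ker (Δ.labelAugmentation 𝕜) :=
      Submodule.quotEquivOfEq _ _ hr
    let e'' : (Δ.Chains 𝕜 0 ⧸ LinearMap.ker (Δ.labelAugmentation 𝕜)) ≃ₗ[MvPolynomial ι 𝕜]
        MvPolynomial ι 𝕜 ⧸ Δ.labelIdeal 𝕜 :=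
      (Δ.labelAugmentation 𝕜).quotKerEquivOfSurjective (labelAugmentation_surjective 𝕜 h)
    exact ⟨e.trans (e'.trans e'')⟩

end LabeledComplex

/-! ### Faces of the bipyramid and lcm-labels -/

theorem Complex.mem_bipyramid {V : Type v} [DecidableEq V] {ω : Finset V} {w₀ w₁ : V}
    {s : Finset V} :
    s ∈ (Complex.bipyramid ω w₀ w₁).faces ↔ s ⊆ insert w₀ ω ∨ s ⊆ insert w₁ ω := by
  constructor
  · rintro ⟨a, ha, b, hb, rfl⟩
    refine ha.imp (fun ha => ?_) (fun ha => ?_) <;>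
    · rw [Finset.insert_eq]
      exact Finset.union_subset_union ha hb
  · rintro (h | h)
    · exact ⟨s ∩ {w₀}, Or.inl Finset.inter_subset_right, s ∩ ω, Finset.inter_subset_right, by
        rw [← Finset.inter_union_distrib_left, ← Finset.insert_eq, Finset.inter_eq_left.2 h]⟩
    · exact ⟨s ∩ {w₁}, Or.inr Finset.inter_subset_right, s ∩ ω, Finset.inter_subset_right, by
        rw [← Finset.inter_union_distrib_left, ← Finset.insert_eq, Finset.inter_eq_left.2 h]⟩

/-- A set of vertices of the bipyramid is a face as soon as it does not contain both apexes. -/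
theorem Complex.mem_bipyramid_of_vertices {V : Type v} [DecidableEq V] {ω : Finset V} {w₀ w₁ : V}
    {s : Finset V} (hs : ∀ x ∈ s, {x} ∈ (Complex.bipyramid ω w₀ w₁).faces)
    (h : ¬ (w₀ ∈ s ∧ w₁ ∈ s)) : s ∈ (Complex.bipyramid ω w₀ w₁).faces := by
  simp only [Complex.mem_bipyramid, Finset.singleton_subset_iff, Finset.mem_insert] at hs
  rw [Complex.mem_bipyramid]
  by_cases h0 : w₀ ∈ s
  · refine Or.inl fun x hx => ?_
    rcases hs x hx with h' | rfl | h'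
    · exact Finset.mem_insert.2 h'
    · exact absurd ⟨h0, hx⟩ h
    · exact Finset.mem_insert_of_mem h'
  · refine Or.inr fun x hx => ?_
    rcases hs x hx with (rfl | h') | h'
    · exact absurd hx h0
    · exact Finset.mem_insert_of_mem h'
    · exact Finset.mem_insert.2 h'

/-- This makes the star of the new vertex the whole subdivision. -/
theorem Complex.union_mem_bipyramid {V : Type v} [DecidableEq V] {ω : Finset V} {w₀ w₁ : V}
    {s : Finset V} (hs : s ∈ (Complex.bipyramid ω w₀ w₁).faces) :
    s ∪ ω ∈ (Complex.bipyramid ω w₀ w₁).faces := by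
  rw [Complex.mem_bipyramid] at hs ⊢
  exact hs.imp (fun h => Finset.union_subset h (Finset.subset_insert _ _))
    (fun h => Finset.union_subset h (Finset.subset_insert _ _))

namespace LabeledComplex

theorem IsLcmLabeled.label_le_iff {V : Type v} {ι : Type w} {Δ : LabeledComplex V ι}
    (hΔ : Δ.IsLcmLabeled) {s : Finset V} (hs : s ∈ Δ.faces) {b : ι →₀ ℕ} :
    Δ.label s ≤ b ↔ ∀ x ∈ s, Δ.label {x} ≤ b := by
  rw [hΔ s hs, Finset.sup_le_iff]

theorem IsLcmLabeled.label_empty {V : Type v} {ι : Type w} {Δ : LabeledComplex V ι}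
    (hΔ : Δ.IsLcmLabeled) (h : ∅ ∈ Δ.faces) : Δ.label ∅ = 0 := by
  rw [hΔ ∅ h, Finset.sup_empty, bot_eq_zero]

end LabeledComplex

/-! ### The stellar subdivision: label ideal and cone vertices -/

namespace IsVirtualCompatibleSubdivision

variable {𝕜 : Type u} [Field 𝕜] {n k : ℕ} {V : Type v} [DecidableEq V]
  {Δ Δ' : LabeledComplex V (Vars n k)} {ω : Finset V} {v' : V}

theorem notMem_of_mem_faces (h : IsVirtualCompatibleSubdivision 𝕜 Δ Δ' ω v') {s : Finset V}
    (hs : s ∈ Δ.faces) : v' ∉ s :=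
  fun hv => h.new_vertex (Δ.down_closed hs (Finset.singleton_subset_iff.2 hv))

theorem mem_faces_of_not_subset (h : IsVirtualCompatibleSubdivision 𝕜 Δ Δ' ω v') {s : Finset V}
    (hs : s ∈ Δ.faces) (hω : ¬ ω ⊆ s) : s ∈ Δ'.faces := by
  rw [h.faces_eq]
  exact Or.inl ⟨hs, hω⟩

theorem mem_and_not_subset (h : IsVirtualCompatibleSubdivision 𝕜 Δ Δ' ω v') {s : Finset V}
    (hs : s ∈ Δ'.faces) (hv : v' ∉ s) : s ∈ Δ.faces ∧ ¬ ω ⊆ s := by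
  rw [h.faces_eq] at hs
  rcases hs with hs | ⟨t, -, -, rfl⟩
  · exact hs
  · exact absurd (Finset.mem_insert_self _ _) hv

theorem newVertex_mem_faces (h : IsVirtualCompatibleSubdivision 𝕜 Δ Δ' ω v')
    (hω : ω.Nonempty) : {v'} ∈ Δ'.faces := by
  rw [h.faces_eq]
  refine Or.inr ⟨∅, by rw [Finset.empty_union]; exact h.mem_faces, ?_, rfl⟩
  rw [Finset.subset_empty]
  exact hω.ne_empty

/-- The label ideal of a subdivision at a point of `ω`. -/
theorem labelIdeal_eq (h : IsVirtualCompatibleSubdivision 𝕜 Δ Δ' ω v') (hω : ω.Nonempty) :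
    Δ'.labelIdeal 𝕜 = Δ.labelIdeal 𝕜 ⊔ Ideal.span {monomial (Δ'.label {v'}) (1 : 𝕜)} := by
  have hv : monomial (Δ'.label {v'}) (1 : 𝕜) ∈ Δ'.labelIdeal 𝕜 :=
    Ideal.subset_span ⟨v', h.newVertex_mem_faces hω, rfl⟩
  apply le_antisymm
  · refine Ideal.span_le.2 ?_
    rintro _ ⟨x, hx, rfl⟩
    by_cases hxv : x = v'
    · subst hxv
      exact Ideal.mem_sup_right (Ideal.subset_span rfl)
    · have hx' := (h.mem_and_not_subset hx (by simpa using Ne.symm hxv)).1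
      rw [h.label_eq _ hx' hx]
      exact Ideal.mem_sup_left (Ideal.subset_span ⟨x, hx', rfl⟩)
  · refine sup_le (Ideal.span_le.2 ?_)
      ((Ideal.span_singleton_le_iff_mem _).2 hv)
    rintro _ ⟨x, hx, rfl⟩
    -- If `ω` is a single vertex, the subdivision removes it; its label stays in the ideal because
    -- `ℓ'(v')` divides `ℓ(ω)`.
    by_cases hωx : ω ⊆ {x}
    · obtain rfl := (Finset.subset_singleton_iff.1 hωx).resolve_left hω.ne_empty
      refine Ideal.mem_of_dvd _ ?_ hv
      exact monomial_dvd_monomial.2 ⟨Or.inr h.label_le, one_dvd _⟩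
    · have hx' := h.mem_faces_of_not_subset hx hωx
      rw [← h.label_eq _ hx hx']
      exact Ideal.subset_span ⟨x, hx', rfl⟩

/-- A bipyramid subdivided at a point of its base, with the label of the new vertex dividing the
least common multiple of the labels of the apexes, has a cone vertex in each multidegree. -/
theorem exists_isConeVertex (h : IsVirtualCompatibleSubdivision 𝕜 Δ Δ' ω v') {w₀ w₁ : V}
    (hΔ : Δ.toComplex = Complex.bipyramid ω w₀ w₁) (hlcm : Δ.IsLcmLabeled)
    (hlcm' : Δ'.IsLcmLabeled) (hdvd : Δ'.label {v'} ≤ Δ.label {w₀} ⊔ Δ.label {w₁}) :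
    ∃ c, Δ'.IsConeVertex c := by
  suffices H : ∀ b, ∃ c, ∀ s ∈ Δ'.faces, s.Nonempty → Δ'.label s ≤ b →
      insert c s ∈ Δ'.faces ∧ Δ'.label (insert c s) ≤ b from ⟨_, fun b => (H b).choose_spec⟩
  intro b
  have hinsert : ∀ {c : V} {s : Finset V}, insert c s ∈ Δ'.faces → Δ'.label {c} ≤ b →
      Δ'.label s ≤ b → Δ'.label (insert c s) ≤ b := by
    intro c s hcs hc hs
    have hs' := Δ'.down_closed hcs (Finset.subset_insert _ _)
    rw [hlcm'.label_le_iff hcs, Finset.forall_mem_insert]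
    exact ⟨hc, (hlcm'.label_le_iff hs').1 hs⟩
  by_cases hv : Δ'.label {v'} ≤ b
  · refine ⟨v', fun s hs _ hsb => ?_⟩
    have hmem : insert v' s ∈ Δ'.faces := by
      by_cases hvs : v' ∈ s
      · rwa [Finset.insert_eq_of_mem hvs]
      · obtain ⟨hs', hωs⟩ := h.mem_and_not_subset hs hvs
        rw [h.faces_eq]
        refine Or.inr ⟨s, ?_, hωs, rfl⟩
        rw [hΔ] at hs' ⊢
        exact Complex.union_mem_bipyramid hs'
    exact ⟨hmem, hinsert hmem hv hsb⟩
  -- From here on `ℓ'(v')` does not divide `x^b`, so only old vertices, with their old labels, occur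
  -- in multidegree `b`.
  have hvertex : ∀ {s : Finset V}, s ∈ Δ'.faces → Δ'.label s ≤ b → ∀ x ∈ s,
      {x} ∈ Δ'.faces ∧ {x} ∈ Δ.faces ∧ Δ'.label {x} ≤ b ∧ Δ.label {x} ≤ b := by
    intro s hs hsb x hx
    have hx' := Δ'.down_closed hs (Finset.singleton_subset_iff.2 hx)
    have hxb := (hlcm'.label_le_iff hs).1 hsb x hx
    have hxv : v' ∉ ({x} : Finset V) := by
      rw [Finset.mem_singleton]
      rintro rfl
      exact hv hxb
    have hxΔ := (h.mem_and_not_subset hx' hxv).1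
    exact ⟨hx', hxΔ, hxb, h.label_eq _ hxΔ hx' ▸ hxb⟩
  -- The subcomplex will be a full simplex, so any vertex `c` of it is an apex; without vertices
  -- there is nothing to cone and the choice of `c` is irrelevant.
  by_cases hex : ∃ s ∈ Δ'.faces, s.Nonempty ∧ Δ'.label s ≤ b
  · obtain ⟨s₀, hs₀, ⟨c, hc⟩, hs₀b⟩ := hex
    obtain ⟨hc', hcΔ, hcb', hcb⟩ := hvertex hs₀ hs₀b c hc
    refine ⟨c, fun s hs _ hsb => ?_⟩
    have hall : ∀ x ∈ insert c s, {x} ∈ Δ.faces ∧ Δ.label {x} ≤ b := by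
      rw [Finset.forall_mem_insert]
      exact ⟨⟨hcΔ, hcb⟩, fun x hx => ⟨(hvertex hs hsb x hx).2.1, (hvertex hs hsb x hx).2.2.2⟩⟩
    have hface : insert c s ∈ Δ.faces := by
      rw [hΔ]
      refine Complex.mem_bipyramid_of_vertices (fun x hx => hΔ ▸ (hall x hx).1) fun hw => ?_
      -- Both apexes present would force `ℓ'(v')` to divide `x^b`.
      exact hv (hdvd.trans (sup_le (hall _ hw.1).2 (hall _ hw.2).2))
    have hmem : insert c s ∈ Δ'.faces := by
      -- Likewise, all of `ω` present would give `ℓ'(v') ∣ ℓ(ω) ∣ x^b`.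
      refine h.mem_faces_of_not_subset hface fun hsub => hv (h.label_le.trans ?_)
      exact (hlcm.label_le_iff h.mem_faces).2 fun x hx => (hall x (hsub hx)).2
    exact ⟨hmem, hinsert hmem hcb' hsb⟩
  · exact ⟨v', fun s hs hne hsb => absurd ⟨s, hs, hne, hsb⟩ hex⟩

end IsVirtualCompatibleSubdivision

end VirtualRes

theorem proposition5p3 {𝕜 : Type*} [Field 𝕜] {n k : ℕ} (hkn : k ≤ n)
    {V : Type*} [LinearOrder V]
    (ω : Finset V) (hω : ω.card = k + 1) (w₀ w₁ : V) (hw : w₀ ≠ w₁) (hw₀ : w₀ ∉ ω) (hw₁ : w₁ ∉ ω)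
    (Δ : VirtualRes.LabeledComplex V (VirtualRes.Vars n k))
    (hΔ : Δ.toComplex = VirtualRes.Complex.bipyramid ω w₀ w₁)
    (hlcm : Δ.IsLcmLabeled)
    (I : Ideal (VirtualRes.CoxRing 𝕜 n k)) (hI : VirtualRes.IsMonomialIdeal I)
    (hvirt : VirtualRes.IsVirtualResolution Δ I)
    (v' : V) (Δ' : VirtualRes.LabeledComplex V (VirtualRes.Vars n k))
    (hlcm' : Δ'.IsLcmLabeled)
    (hsub : VirtualRes.IsVirtualCompatibleSubdivision 𝕜 Δ Δ' ω v')
    (hdvd : Δ'.label {v'} ≤ Δ.label {w₀} ⊔ Δ.label {w₁}) :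
    VirtualRes.IsFreeResolution (Δ'.freeComplex 𝕜)
      (VirtualRes.CoxRing 𝕜 n k ⧸
        (Δ.labelIdeal 𝕜 ⊔ Ideal.span {MvPolynomial.monomial (Δ'.label {v'}) (1 : 𝕜)})) := by
  have hne : ω.Nonempty := Finset.card_pos.1 (by omega)
  have hempty : ∅ ∈ Δ'.faces :=
    Δ'.down_closed (hsub.newVertex_mem_faces hne) (Finset.empty_subset _)
  obtain ⟨c, hc⟩ := hsub.exists_isConeVertex hΔ hlcm hlcm' hdvd
  rw [← hsub.labelIdeal_eq hne]
  exact VirtualRes.LabeledComplex.isFreeResolution_of_isConeVertex 𝕜 hempty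
    (hlcm'.label_empty hempty) hc
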